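/- Let $\Omega\subset\mathbb R^2$ be a bounded domain (nonempty, open, connected) with area $|\Omega|$, let $\beta>0$, and let $A(x)=\frac{\beta}{2}(-x_2,x_1)$ be the standard potential of the constant magnetic field $\beta$. For $u\in H^1(\Omega)=H^1(\Omega;\mathbb C)$ put $\nabla^A u=\nabla u-iuA$. Consider the magnetic Neumann eigenvalue problem in its weak form: a real number $\lambda$ is an eigenvalue if there is $0\ne u\in H^1(\Omega)$ with $$\int_\Omega \nabla^A u\cdot\overline{\nabla^A\phi}\,dx=\lambda\int_\Omega u\,\overline{\phi}\,dx\qquad\text{for all }\phi\in H^1(\Omega).$$ Assume that the spectrum of this problem is discrete, i.e. $L^2(\Omega)$ has an orthonormal basis of eigenfunctions whose eigenvalues have finite multiplicity and form a sequence diverging to $+\infty$ (this holds, for instance, if $\Omega$ is Lipschitz), and let $\lambda_1(\Omega,\beta)\le\lambda_2(\Omega,\beta)\le\cdots$ be the eigenvalues, repeated according to multiplicity. Let $\psi(a)=a-[a]-\frac12$ for $a\in\mathbb R$, where $[a]$ is the integer part (floor) of $a$. Then for every integer $k\ge 0$ $$\lambda_{k+1}(\Omega,\beta)\le\frac{4\pi}{|\Omega|}\left(k+\sqrt{k^2+\frac{\beta^2|\Omega|^2}{4\pi^2}\,\psi^2\!\left(\frac{\lambda_{k+1}(\Omega,\beta)}{2\beta}+\frac12\right)}\right),$$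 and in particular $$\lambda_{k+1}(\Omega,\beta)\le\frac{8\pi k}{|\Omega|}+\beta .$$ -/

import Mathlib

open MeasureTheory Filter Set
open scoped ContDiff ComplexConjugate

namespace MagneticNeumann

/-- The Euclidean plane. -/
abbrev Plane : Type := EuclideanSpace ℝ (Fin 2)

/-- The complex Hilbert space `L²(Ω)`, with respect to Lebesgue measure on `Ω`. -/
abbrev L2 (Ω : Set Plane) : Type := Lp ℂ 2 (volume.restrict Ω)

/-- `g` is the weak partial derivative of `u` on `Ω` in the `i`-th coordinate direction:
`∫_Ω u ∂ᵢφ = - ∫_Ω g φ` for every test function `φ ∈ C_c^∞(Ω)`. -/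
def HasWeakPartial (Ω : Set Plane) (i : Fin 2) (u g : L2 Ω) : Prop :=
  ∀ φ : Plane → ℝ, ContDiff ℝ ∞ φ → HasCompactSupport φ → tsupport φ ⊆ Ω →
    ∫ x in Ω, ((fderiv ℝ φ x (EuclideanSpace.single i 1) : ℝ) : ℂ) * u x =
      - ∫ x in Ω, ((φ x : ℝ) : ℂ) * g x

/-- An element of the Sobolev space `H¹(Ω)`: a function in `L²(Ω)` together with its weak gradient
in `L²(Ω)` (which is determined by the function when `Ω` is open). -/
structure H1 (Ω : Set Plane) where
  /-- the function -/
  toL2 : L2 Ω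
  /-- its weak partial derivatives -/
  grad : Fin 2 → L2 Ω
  hasWeakPartial : ∀ i, HasWeakPartial Ω i toL2 (grad i)

/-- The standard vector potential `A(x) = (β / 2) (-x₂, x₁)` of the constant magnetic field `β`
(the coordinates `x₁, x₂` are `x 0, x 1`). -/
noncomputable def potential (β : ℝ) (x : Plane) : Fin 2 → ℝ :=
  ![-(β / 2) * x 1, β / 2 * x 0]

/-- The magnetic gradient `∇ᴬ u = ∇u - i u A`, componentwise. -/
noncomputable def magneticGrad {Ω : Set Plane} (β : ℝ) (u : H1 Ω) (i : Fin 2) (x : Plane) : ℂ :=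
  u.grad i x - Complex.I * u.toL2 x * (potential β x i : ℂ)

/-- The quadratic (sesquilinear) form of the magnetic Neumann Laplacian,
`∫_Ω ∇ᴬu · conj (∇ᴬφ)`. -/
noncomputable def magneticForm {Ω : Set Plane} (β : ℝ) (u φ : H1 Ω) : ℂ :=
  ∫ x in Ω, ∑ i, magneticGrad β u i x * conj (magneticGrad β φ i x)

/-- `u` is a weak solution of `Δ_A u = lam u` in `Ω` with magnetic Neumann boundary conditions:
`u ∈ H¹(Ω)` and `∫_Ω ∇ᴬu · conj (∇ᴬφ) = lam ∫_Ω u conj φ` for all `φ ∈ H¹(Ω)`.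
A nonzero such `u` is an eigenfunction with eigenvalue `lam`. -/
def IsWeakSolution (Ω : Set Plane) (β lam : ℝ) (u : L2 Ω) : Prop :=
  ∃ U : H1 Ω, U.toL2 = u ∧ ∀ φ : H1 Ω,
    magneticForm β U φ = (lam : ℂ) * ∫ x in Ω, u x * conj (φ.toL2 x)

/-- The magnetic Neumann Laplacian on `Ω` with field `β` has discrete spectrum: `L²(Ω)` has an
orthonormal (Hilbert) basis of eigenfunctions whose eigenvalues, repeated with multiplicity, form
a nondecreasing sequence tending to `+∞`. -/
def HasDiscreteSpectrum (Ω : Set Plane) (β : ℝ) : Prop :=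
  ∃ (lam : ℕ → ℝ) (e : HilbertBasis ℕ ℂ (L2 Ω)),
    Monotone lam ∧ Tendsto lam atTop atTop ∧ ∀ j, IsWeakSolution Ω β (lam j) (e j)

/-- The `j`-th eigenvalue `λ_j(Ω, β)`, `j ≥ 1`, in increasing order and counted with multiplicity:
the least `t` such that there are `j` linearly independent eigenfunctions whose eigenvalues are
at most `t`. -/
noncomputable def eigenvalue (Ω : Set Plane) (β : ℝ) (j : ℕ) : ℝ :=
  sInf {t : ℝ | ∃ v : Fin j → L2 Ω, LinearIndependent ℂ v ∧
    ∀ i, ∃ lam : ℝ, lam ≤ t ∧ IsWeakSolution Ω β lam (v i)}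

/-- The fluctuation function `ψ(a) = a - [a] - 1/2`, with `[a]` the integer part of `a`. -/
noncomputable def fluctuation (a : ℝ) : ℝ := a - (⌊a⌋ : ℝ) - 1 / 2

end MagneticNeumann

namespace MagneticNeumann

/-! ### Hermite functions: orthonormality and oscillator energy. -/

section Hermite

open Polynomial

/-! The proof is an averaged variational principle, tested on the Landau functions `landauFun β m
ξ`, the generalised eigenfunctions on the whole plane. Neumann conditions allow their restrictions
to Ω as trial functions. For any f in H¹, expanding in eigenfunctions gives λ_{k+1}‖f‖² ≤ ‖∇ᴬf‖² +
Σ_{j≤k} (λ_{k+1} − λ_j)|⟨e_j, f⟩|² (`variational_inequality`), and λ_j ≥ 0 may be dropped.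

Integrate over ξ ∈ ℝ and sum over the levels m < M. Since ξ translates the Hermite profile, the
ξ-integrals of |f|² and |∇ᴬf|² are the same at every point: √(β/2) and √(β/2)·β(2m+1). Hence only
the area of Ω enters (`lintegral_norm_landauH1_sq`, `lintegral_norm_magneticGradL2_landauH1_sq`).
The Landau functions are orthogonal in a continuous sense, so each e_j contributes at most 2π/√(2β),
whatever M is (`lintegral_sum_inner_landauH1_le`).

The outcome is β|Ω|(λM − βM²) ≤ 2πkλ for λ = λ_{k+1} and every M (`averaged_inequality`). The
integer M nearest to λ/(2β) turns the left side into |Ω|(λ²/4 − β²ψ²), and solving the quadratic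
inequality for λ gives the bound. -/

theorem integrable_polynomial_mul_gaussian (p : ℝ[X]) :
    Integrable fun x : ℝ => p.eval x * Real.exp (-x ^ 2 / 2) := by
  induction p using Polynomial.induction_on' with
  | add p q hp hq =>
    refine (hp.add hq).congr (Eventually.of_forall fun x => ?_)
    simp [add_mul]
  | monomial n a =>
    have h := (integrable_rpow_mul_exp_neg_mul_sq (b := 1 / 2) (by norm_num)
      (s := n) (by have : (0 : ℝ) ≤ n := n.cast_nonneg
                   linarith)).const_mul a
    refine h.congr (Eventually.of_forall fun x => ?_)
    simp only [eval_monomial, Real.rpow_natCast]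
    rw [mul_assoc]
    congr 3
    ring

/-- The unnormalised Gaussian expectation of a polynomial. -/
noncomputable def gaussianMean (p : ℝ[X]) : ℝ := ∫ x : ℝ, p.eval x * Real.exp (-x ^ 2 / 2)

theorem gaussianMean_add (p q : ℝ[X]) :
    gaussianMean (p + q) = gaussianMean p + gaussianMean q := by
  simp only [gaussianMean, eval_add, add_mul]
  exact integral_add (integrable_polynomial_mul_gaussian p) (integrable_polynomial_mul_gaussian q)

theorem gaussianMean_C_mul (a : ℝ) (p : ℝ[X]) :
    gaussianMean (C a * p) = a * gaussianMean p := by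
  simp only [gaussianMean, eval_mul, eval_C, mul_assoc, integral_const_mul]

theorem gaussianMean_sub (p q : ℝ[X]) :
    gaussianMean (p - q) = gaussianMean p - gaussianMean q := by
  have h := gaussianMean_add (p - q) q
  rw [sub_add_cancel] at h
  linarith

theorem gaussianMean_one : gaussianMean 1 = Real.sqrt (2 * Real.pi) := by
  have h := integral_gaussian (1 / 2)
  rw [gaussianMean]
  convert h using 2
  · ext x
    simp only [eval_one, one_mul]
    congr 1
    ring
  · ring

theorem hasDerivAt_exp_neg_sq (x : ℝ) (c : ℝ) :
    HasDerivAt (fun x : ℝ => Real.exp (-x ^ 2 / c)) (Real.exp (-x ^ 2 / c) * (-(2 * x) / c)) x := by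
  have h := (((hasDerivAt_pow 2 x).neg).div_const c).exp
  simpa using h

/-- Gaussian integration by parts: the derivative of p(x)e^{-x²/2} has integral zero. -/
theorem gaussianMean_X_mul (p : ℝ[X]) :
    gaussianMean (X * p) = gaussianMean (derivative p) := by
  have h : ∫ x : ℝ, (derivative p - X * p).eval x * Real.exp (-x ^ 2 / 2) = 0 := by
    refine integral_eq_zero_of_hasDerivAt_of_integrable
      (f := fun x => p.eval x * Real.exp (-x ^ 2 / 2)) (fun x => ?_)
      (integrable_polynomial_mul_gaussian _) (integrable_polynomial_mul_gaussian _)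
    refine ((p.hasDerivAt x).mul (hasDerivAt_exp_neg_sq x 2)).congr_deriv ?_
    rw [eval_sub, eval_mul, eval_X]
    ring
  have h' := gaussianMean_sub (derivative p) (X * p)
  rw [gaussianMean, h] at h'
  linarith

/-- The probabilists' Hermite polynomials with real coefficients. -/
noncomputable def hermiteReal (n : ℕ) : ℝ[X] := (hermite n).map (Int.castRingHom ℝ)

theorem hermiteReal_zero : hermiteReal 0 = 1 := by simp [hermiteReal]

theorem hermiteReal_succ (n : ℕ) :
    hermiteReal (n + 1) = X * hermiteReal n - derivative (hermiteReal n) := by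
  simp [hermiteReal, hermite_succ]

theorem derivative_hermiteReal_succ (n : ℕ) :
    derivative (hermiteReal (n + 1)) = C ((n : ℝ) + 1) * hermiteReal n := by
  induction n with
  | zero => simp [hermiteReal_succ, hermiteReal_zero]
  | succ n ih =>
    rw [hermiteReal_succ (n + 1), derivative_sub, derivative_mul, derivative_X, one_mul, ih,
      derivative_C_mul]
    rw [hermiteReal_succ n]
    push_cast
    simp only [map_add, map_one]
    ring

/-- The operator X − d/dx that raises Hermite polynomials is adjoint to d/dx under the Gaussian
weight; iterating this yields orthogonality. -/
theorem gaussianMean_hermiteReal_succ_mul (n : ℕ) (q : ℝ[X]) :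
    gaussianMean (hermiteReal (n + 1) * q) = gaussianMean (hermiteReal n * derivative q) := by
  rw [hermiteReal_succ, sub_mul, gaussianMean_sub, mul_assoc, gaussianMean_X_mul, derivative_mul,
    gaussianMean_add]
  ring

theorem gaussianMean_hermiteReal_mul (m n : ℕ) :
    gaussianMean (hermiteReal m * hermiteReal n) =
      if m = n then (m.factorial : ℝ) * Real.sqrt (2 * Real.pi) else 0 := by
  have hz : gaussianMean 0 = 0 := by simp [gaussianMean]
  induction m generalizing n with
  | zero =>
    cases n with
    | zero => simp [hermiteReal_zero, gaussianMean_one]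
    | succ n => rw [mul_comm, gaussianMean_hermiteReal_succ_mul]; simp [hermiteReal_zero, hz]
  | succ m ih =>
    cases n with
    | zero => rw [gaussianMean_hermiteReal_succ_mul]; simp [hermiteReal_zero, hz]
    | succ n =>
      rw [gaussianMean_hermiteReal_succ_mul, derivative_hermiteReal_succ, mul_left_comm,
        gaussianMean_C_mul, ih]
      by_cases h : m = n
      · subst h
        simp [Nat.factorial_succ]
        ring
      · simp [h]

/-- The normalisation constant of the Hermite functions. -/
noncomputable def hermiteNorm (m : ℕ) : ℝ := (m.factorial : ℝ) * Real.sqrt (2 * Real.pi)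

theorem hermiteNorm_pos (m : ℕ) : 0 < hermiteNorm m := by
  unfold hermiteNorm
  positivity

/-- The normalised Hermite functions. -/
noncomputable def hermiteFun (m : ℕ) (s : ℝ) : ℝ :=
  (Real.sqrt (hermiteNorm m))⁻¹ * ((hermiteReal m).eval s * Real.exp (-s ^ 2 / 4))

/-- The derivatives of the normalised Hermite functions. -/
noncomputable def hermiteFunDeriv (m : ℕ) (s : ℝ) : ℝ :=
  (Real.sqrt (hermiteNorm m))⁻¹ *
    ((derivative (hermiteReal m) - C (1 / 2) * (X * hermiteReal m)).eval s * Real.exp (-s ^ 2 / 4))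

theorem hasDerivAt_hermiteFun (m : ℕ) (s : ℝ) :
    HasDerivAt (hermiteFun m) (hermiteFunDeriv m s) s := by
  have h := (((hermiteReal m).hasDerivAt s).mul
    (hasDerivAt_exp_neg_sq s 4)).const_mul (Real.sqrt (hermiteNorm m))⁻¹
  refine h.congr_deriv ?_
  rw [hermiteFunDeriv, eval_sub, eval_mul, eval_mul, eval_C, eval_X]
  ring

theorem continuous_hermiteFunDeriv (m : ℕ) : Continuous (hermiteFunDeriv m) := by
  unfold hermiteFunDeriv
  fun_prop

theorem continuous_hermiteFun (m : ℕ) : Continuous (hermiteFun m) := by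
  unfold hermiteFun
  fun_prop

theorem exp_neg_sq_div_four_sq (s : ℝ) :
    Real.exp (-s ^ 2 / 4) * Real.exp (-s ^ 2 / 4) = Real.exp (-s ^ 2 / 2) := by
  rw [← Real.exp_add]
  congr 1
  ring

theorem hermiteFun_mul (m n : ℕ) (s : ℝ) :
    hermiteFun m s * hermiteFun n s = (Real.sqrt (hermiteNorm m))⁻¹ *
      (Real.sqrt (hermiteNorm n))⁻¹ *
        ((hermiteReal m * hermiteReal n).eval s * Real.exp (-s ^ 2 / 2)) := by
  rw [← exp_neg_sq_div_four_sq]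
  simp only [hermiteFun, eval_mul]
  ring

theorem integrable_hermiteFun_mul (m n : ℕ) :
    Integrable fun s => hermiteFun m s * hermiteFun n s := by
  simp only [hermiteFun_mul]
  exact (integrable_polynomial_mul_gaussian _).const_mul _

theorem integral_hermiteFun_mul (m n : ℕ) :
    ∫ s, hermiteFun m s * hermiteFun n s = if m = n then 1 else 0 := by
  simp only [hermiteFun_mul]
  rw [integral_const_mul]
  have h := gaussianMean_hermiteReal_mul m n
  rw [gaussianMean] at h
  rw [h]
  by_cases hmn : m = n
  · subst hmn
    have hp := hermiteNorm_pos m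
    have hs := Real.mul_self_sqrt hp.le
    have hs0 : Real.sqrt (hermiteNorm m) ≠ 0 := (Real.sqrt_pos.2 hp).ne'
    simp only [if_true]
    change _ * _ * hermiteNorm m = 1
    nth_rewrite 3 [← hs]
    field_simp
  · simp [hmn]

/-- The energy density of the harmonic oscillator on the `m`-th Hermite function. -/
noncomputable def hermiteEnergy (m : ℕ) (s : ℝ) : ℝ :=
  (s / 2 * hermiteFun m s) ^ 2 + hermiteFunDeriv m s ^ 2

/-- The parallelogram identity a² + b² = ((a − b)² + (a + b)²)/2 with a = (s/2)h and b = h′: the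
raising operator a − b produces the polynomial of degree m + 1, and the lowering operator a + b
produces the derivative. -/
theorem hermiteEnergy_eq (m : ℕ) (s : ℝ) :
    hermiteEnergy m s = (2 * hermiteNorm m)⁻¹ *
      ((hermiteReal (m + 1) * hermiteReal (m + 1) +
        derivative (hermiteReal m) * derivative (hermiteReal m)).eval s *
          Real.exp (-s ^ 2 / 2)) := by
  have hs := Real.mul_self_sqrt (hermiteNorm_pos m).le
  rw [← exp_neg_sq_div_four_sq, mul_inv]
  nth_rewrite 1 [← hs]
  rw [mul_inv]
  simp only [hermiteEnergy, hermiteFun, hermiteFunDeriv, hermiteReal_succ, eval_add, eval_sub,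
    eval_mul, eval_C, eval_X]
  ring

theorem integrable_hermiteEnergy (m : ℕ) : Integrable (hermiteEnergy m) := by
  rw [funext (hermiteEnergy_eq m)]
  exact (integrable_polynomial_mul_gaussian _).const_mul _

theorem integral_hermiteEnergy (m : ℕ) : ∫ s, hermiteEnergy m s = (2 * m + 1) / 2 := by
  have hn := hermiteNorm_pos m
  have h1 := gaussianMean_hermiteReal_mul (m + 1) (m + 1)
  have h2 : gaussianMean (derivative (hermiteReal m) * derivative (hermiteReal m)) =
      m * hermiteNorm m := by
    cases m with
    | zero => simp [hermiteReal_zero, gaussianMean]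
    | succ m =>
      rw [derivative_hermiteReal_succ, mul_mul_mul_comm, ← C_mul, gaussianMean_C_mul,
        gaussianMean_hermiteReal_mul]
      simp only [hermiteNorm, Nat.factorial_succ, if_true]
      push_cast
      ring
  rw [if_pos rfl, Nat.factorial_succ] at h1
  simp only [hermiteEnergy_eq]
  rw [integral_const_mul]
  change _ * gaussianMean _ = _
  rw [gaussianMean_add, h1, h2]
  push_cast
  rw [mul_assoc ((m : ℝ) + 1)]
  change _ * ((m + 1) * hermiteNorm m + _) = _
  field_simp
  ring

end Hermite

/-! ### The variational inequality in abstract Hilbert spaces. -/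

section VariationalPrinciple

variable {H K : Type*} [NormedAddCommGroup H] [InnerProductSpace ℂ H]
  [NormedAddCommGroup K] [InnerProductSpace ℂ K]

/-- Bessel's inequality for the energy form, with g and F playing the gradients of e and f. It comes
from ‖F − S‖² ≥ 0 for the truncated expansion S; leaving g unnormalised avoids dividing by
eigenvalues that may vanish. -/
theorem sum_mul_norm_inner_sq_le {e : ℕ → H} (he : Orthonormal ℂ e) {g : ℕ → K} {lam : ℕ → ℝ}
    (hg : ∀ i j, inner ℂ (g i) (g j) = (lam j : ℂ) * inner ℂ (e i) (e j)) {f : H} {F : K}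
    (hF : ∀ j, inner ℂ F (g j) = (lam j : ℂ) * inner ℂ f (e j)) (N : ℕ) :
    ∑ j ∈ Finset.range N, lam j * ‖inner ℂ (e j) f‖ ^ 2 ≤ ‖F‖ ^ 2 := by
  set S : K := ∑ j ∈ Finset.range N, (inner ℂ (e j) f : ℂ) • g j with hS
  have hnorm : ∀ j, (lam j : ℂ) * ((inner ℂ (e j) f : ℂ) * inner ℂ f (e j)) =
      ((lam j * ‖inner ℂ (e j) f‖ ^ 2 : ℝ) : ℂ) := by
    intro j
    rw [← inner_conj_symm f (e j), Complex.mul_conj, Complex.normSq_eq_norm_sq]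
    push_cast
    ring
  have h1 : inner ℂ F S = ((∑ j ∈ Finset.range N, lam j * ‖inner ℂ (e j) f‖ ^ 2 : ℝ) : ℂ) := by
    rw [hS, inner_sum, Complex.ofReal_sum]
    refine Finset.sum_congr rfl fun j _ => ?_
    rw [inner_smul_right, hF, ← hnorm]
    ring
  have h2 : inner ℂ S S = ((∑ j ∈ Finset.range N, lam j * ‖inner ℂ (e j) f‖ ^ 2 : ℝ) : ℂ) := by
    rw [hS, inner_sum, Complex.ofReal_sum]
    refine Finset.sum_congr rfl fun j hj => ?_
    rw [inner_smul_right, sum_inner, Finset.sum_eq_single j]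
    · rw [inner_smul_left, hg, inner_conj_symm, orthonormal_iff_ite.1 he, if_pos rfl, ← hnorm]
      ring
    · intro i _ hij
      rw [inner_smul_left, hg, orthonormal_iff_ite.1 he, if_neg hij, mul_zero, mul_zero]
    · exact fun h => absurd hj h
  have h3 := norm_sub_sq (𝕜 := ℂ) F S
  rw [h1, ← inner_self_eq_norm_sq (𝕜 := ℂ) S, h2] at h3
  simp only [RCLike.re_to_complex, Complex.ofReal_re] at h3
  nlinarith [sq_nonneg ‖F - S‖]

theorem hasSum_norm_inner_sq (e : HilbertBasis ℕ ℂ H) (f : H) :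
    HasSum (fun j => ‖inner ℂ (e j) f‖ ^ 2) (‖f‖ ^ 2) := by
  have h := Complex.hasSum_re (e.hasSum_inner_mul_inner f f)
  have hf : (inner ℂ f f : ℂ).re = ‖f‖ ^ 2 := inner_self_eq_norm_sq (𝕜 := ℂ) f
  rw [hf] at h
  convert h using 2 with j
  rw [← inner_conj_symm f (e j), mul_comm, Complex.mul_conj, Complex.normSq_eq_norm_sq,
    Complex.ofReal_re]

/-- The variational inequality behind the averaged variational principle. -/
theorem variational_inequality (e : HilbertBasis ℕ ℂ H) {g : ℕ → K} {lam : ℕ → ℝ}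
    (hlam : Monotone lam)
    (hg : ∀ i j, inner ℂ (g i) (g j) = (lam j : ℂ) * inner ℂ (e i) (e j)) {f : H} {F : K}
    (hF : ∀ j, inner ℂ F (g j) = (lam j : ℂ) * inner ℂ f (e j)) (k : ℕ) :
    lam k * ‖f‖ ^ 2 ≤
      ‖F‖ ^ 2 + ∑ j ∈ Finset.range k, (lam k - lam j) * ‖inner ℂ (e j) f‖ ^ 2 := by
  have ht := ((hasSum_norm_inner_sq e f).tendsto_sum_nat).const_mul (lam k)
  -- By Parseval it suffices to treat partial sums with N ≥ k; there the terms with j ≥ k carry the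
  -- nonpositive weight `lam k - lam j`.
  refine le_of_tendsto ht (eventually_atTop.2 ⟨k, fun N hN => ?_⟩)
  have h1 := sum_mul_norm_inner_sq_le e.orthonormal hg hF N
  rw [Finset.mul_sum]
  have h2 : ∑ j ∈ Finset.range N, (lam k - lam j) * ‖inner ℂ (e j) f‖ ^ 2 ≤
      ∑ j ∈ Finset.range k, (lam k - lam j) * ‖inner ℂ (e j) f‖ ^ 2 := by
    rw [← Finset.sum_range_add_sum_Ico _ hN, add_le_iff_nonpos_right]
    refine Finset.sum_nonpos fun j hj => ?_
    exact mul_nonpos_of_nonpos_of_nonneg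
      (sub_nonpos.2 (hlam (Finset.mem_Ico.1 hj).1)) (sq_nonneg _)
  simp only [sub_mul, Finset.sum_sub_distrib] at h2 ⊢
  linarith

end VariationalPrinciple

/-! ### The magnetic form as an inner product, and identification of the eigenvalues. -/

section MagneticGradient

variable {Ω : Set Plane}

theorem continuous_potential (β : ℝ) (i : Fin 2) : Continuous fun x => potential β x i := by
  fin_cases i
  · simp only [potential]
    change Continuous fun x : Plane => -(β / 2) * x 1
    fun_prop
  · change Continuous fun x : Plane => β / 2 * x 0
    fun_prop

theorem exists_norm_le_of_continuous {E : Type*} [NormedAddCommGroup E]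
    (hbdd : Bornology.IsBounded Ω) {f : Plane → E}
    (hf : Continuous f) : ∃ C, ∀ x ∈ Ω, ‖f x‖ ≤ C := by
  obtain ⟨C, hC⟩ := hbdd.isCompact_closure.exists_bound_of_continuousOn hf.continuousOn
  exact ⟨C, fun x hx => hC x (subset_closure hx)⟩

theorem memLp_magneticGrad (hopen : IsOpen Ω) (hbdd : Bornology.IsBounded Ω) (β : ℝ) (u : H1 Ω)
    (i : Fin 2) : MemLp (magneticGrad β u i) 2 (volume.restrict Ω) := by
  have hc : Continuous fun x => (potential β x i : ℂ) :=
    Complex.continuous_ofReal.comp (continuous_potential β i)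
  obtain ⟨C, hC⟩ := exists_norm_le_of_continuous hbdd hc
  have hp : MemLp (fun x => (potential β x i : ℂ)) ⊤ (volume.restrict Ω) :=
    memLp_top_of_bound hc.aestronglyMeasurable C
      (ae_restrict_of_forall_mem hopen.measurableSet hC)
  exact (Lp.memLp _).sub (hp.mul' (r := 2) ((Lp.memLp u.toL2).const_mul Complex.I))

/-- The magnetic gradient as an element of `L²(Ω; ℂ²)`. -/
noncomputable def magneticGradL2 (hopen : IsOpen Ω) (hbdd : Bornology.IsBounded Ω) (β : ℝ)
    (u : H1 Ω) : PiLp 2 fun _ : Fin 2 => L2 Ω :=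
  WithLp.toLp 2 fun i => (memLp_magneticGrad hopen hbdd β u i).toLp _

theorem magneticForm_eq_inner (hopen : IsOpen Ω) (hbdd : Bornology.IsBounded Ω) (β : ℝ)
    (u φ : H1 Ω) : magneticForm β u φ =
      inner ℂ (magneticGradL2 hopen hbdd β φ) (magneticGradL2 hopen hbdd β u) := by
  rw [PiLp.inner_apply, magneticForm]
  simp only [L2.inner_def]
  rw [← integral_finsetSum _ fun i _ => L2.integrable_inner _ _]
  refine integral_congr_ae ?_
  have h : ∀ v : H1 Ω, ∀ᵐ x ∂volume.restrict Ω, ∀ i,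
      magneticGradL2 hopen hbdd β v i x = magneticGrad β v i x := fun v =>
    ae_all_iff.2 fun i => (memLp_magneticGrad hopen hbdd β v i).coeFn_toLp
  filter_upwards [h u, h φ] with x hu hφ
  simp only [RCLike.inner_apply, hu, hφ]

theorem integral_mul_conj_eq_inner (u v : L2 Ω) :
    ∫ x in Ω, u x * conj (v x) = inner ℂ v u := rfl

theorem isWeakSolution_iff (hopen : IsOpen Ω) (hbdd : Bornology.IsBounded Ω) {β lam : ℝ}
    {u : L2 Ω} : IsWeakSolution Ω β lam u ↔ ∃ U : H1 Ω, U.toL2 = u ∧ ∀ φ : H1 Ω,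
      inner ℂ (magneticGradL2 hopen hbdd β φ) (magneticGradL2 hopen hbdd β U) =
        (lam : ℂ) * inner ℂ φ.toL2 u := by
  simp only [IsWeakSolution, magneticForm_eq_inner hopen hbdd, integral_mul_conj_eq_inner]

theorem IsWeakSolution.nonneg (hopen : IsOpen Ω) (hbdd : Bornology.IsBounded Ω) {β lam : ℝ}
    {u : L2 Ω} (h : IsWeakSolution Ω β lam u) (hu : u ≠ 0) : 0 ≤ lam := by
  obtain ⟨U, rfl, hU⟩ := (isWeakSolution_iff hopen hbdd).1 h
  have h2 : ‖magneticGradL2 hopen hbdd β U‖ ^ 2 = lam * ‖U.toL2‖ ^ 2 := by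
    rw [← inner_self_eq_norm_sq (𝕜 := ℂ), ← inner_self_eq_norm_sq (𝕜 := ℂ), hU U]
    exact Complex.re_ofReal_mul _ _
  have h3 : 0 < ‖U.toL2‖ ^ 2 := by
    have := norm_pos_iff.2 hu
    positivity
  nlinarith [sq_nonneg ‖magneticGradL2 hopen hbdd β U‖]

theorem IsWeakSolution.inner_eq_zero (hopen : IsOpen Ω) (hbdd : Bornology.IsBounded Ω)
    {β lam mu : ℝ} {u v : L2 Ω} (hu : IsWeakSolution Ω β lam u) (hv : IsWeakSolution Ω β mu v)
    (hne : lam ≠ mu) : inner ℂ u v = (0 : ℂ) := by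
  obtain ⟨U, rfl, hU⟩ := (isWeakSolution_iff hopen hbdd).1 hu
  obtain ⟨V, rfl, hV⟩ := (isWeakSolution_iff hopen hbdd).1 hv
  have h1 := congrArg conj (hU V)
  rw [inner_conj_symm, map_mul, inner_conj_symm, Complex.conj_ofReal, hV U] at h1
  have h2 : ((mu : ℂ) - lam) * inner ℂ U.toL2 V.toL2 = 0 := by rw [sub_mul, h1, sub_self]
  refine (mul_eq_zero.1 h2).resolve_left ?_
  exact sub_ne_zero.2 (Complex.ofReal_injective.ne hne.symm)

theorem eq_zero_of_forall_inner_hilbertBasis_eq_zero {H : Type*} [NormedAddCommGroup H]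
    [InnerProductSpace ℂ H] (e : HilbertBasis ℕ ℂ H) {x : H} (hx : ∀ j, inner ℂ (e j) x = 0) :
    x = 0 := by
  have h := hasSum_norm_inner_sq e x
  simp only [hx, norm_zero, ne_eq, OfNat.ofNat_ne_zero, not_false_eq_true, zero_pow] at h
  simpa using h.unique hasSum_zero

/-- Ties the intrinsic counting definition to the given eigenbasis. Below `lam k`, eigenfunctions
are orthogonal to every `e j` with j ≥ k, so at most k of them are independent. -/
theorem eigenvalue_eq (hopen : IsOpen Ω) (hbdd : Bornology.IsBounded Ω) {β : ℝ} {lam : ℕ → ℝ}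
    {e : HilbertBasis ℕ ℂ (L2 Ω)} (hlam : Monotone lam)
    (he : ∀ j, IsWeakSolution Ω β (lam j) (e j)) (k : ℕ) :
    eigenvalue Ω β (k + 1) = lam k := by
  refine IsLeast.csInf_eq ⟨⟨fun i => e i, ?_, fun i => ⟨lam i, hlam (by omega), he i⟩⟩, ?_⟩
  · exact e.orthonormal.linearIndependent.comp _ Fin.val_injective
  · rintro t ⟨v, hv, hvt⟩
    by_contra! hlt
    have horth : ∀ i, ∀ j, k ≤ j → inner ℂ (e j) (v i) = (0 : ℂ) := by
      intro i j hj
      obtain ⟨mu, hmu, hsol⟩ := hvt i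
      exact (he j).inner_eq_zero hopen hbdd hsol
        ((hmu.trans_lt (hlt.trans_le (hlam hj))).ne')
    -- The first k coordinates are injective on the span of `v`, since all others vanish there; k +
    -- 1 independent vectors would then lie in ℂᵏ.
    let T : L2 Ω →ₗ[ℂ] (Fin k → ℂ) := LinearMap.pi fun j => (innerSL ℂ (e j)).toLinearMap
    have hdisj : Disjoint (Submodule.span ℂ (range v)) (LinearMap.ker T) := by
      rw [Submodule.disjoint_def]
      intro x hx hxT
      refine eq_zero_of_forall_inner_hilbertBasis_eq_zero e fun j => ?_
      rcases lt_or_ge j k with hj | hj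
      · exact congrFun (LinearMap.mem_ker.1 hxT) ⟨j, hj⟩
      · have hle : Submodule.span ℂ (range v) ≤ LinearMap.ker (innerSL ℂ (e j)).toLinearMap := by
          rw [Submodule.span_le]
          rintro _ ⟨i, rfl⟩
          exact horth i j hj
        exact hle hx
    have hcard := (hv.map hdisj).fintype_card_le_finrank
    simp at hcard

/-- The variational inequality for the magnetic Neumann Laplacian. -/
theorem eigenvalue_mul_norm_sq_le (hopen : IsOpen Ω) (hbdd : Bornology.IsBounded Ω) {β : ℝ}
    {lam : ℕ → ℝ} {e : HilbertBasis ℕ ℂ (L2 Ω)} (hlam : Monotone lam)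
    (he : ∀ j, IsWeakSolution Ω β (lam j) (e j)) (k : ℕ) (f : H1 Ω) :
    lam k * ‖f.toL2‖ ^ 2 ≤ ‖magneticGradL2 hopen hbdd β f‖ ^ 2 +
      ∑ j ∈ Finset.range k, (lam k - lam j) * ‖inner ℂ (e j) f.toL2‖ ^ 2 := by
  choose U hU hsol using fun j => (isWeakSolution_iff hopen hbdd).1 (he j)
  refine variational_inequality e hlam (g := fun j => magneticGradL2 hopen hbdd β (U j))
    (fun i j => ?_) (fun j => hsol j f) k
  rw [hsol j (U i), hU i]

end MagneticGradient

/-! ### Landau functions as trial functions, and their averages over ξ. -/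

section TestFunctions

variable {Ω : Set Plane}

theorem memLp_restrict_of_continuous (hopen : IsOpen Ω) (hbdd : Bornology.IsBounded Ω)
    {f : Plane → ℂ} (hf : Continuous f) : MemLp f 2 (volume.restrict Ω) := by
  obtain ⟨C, hC⟩ := exists_norm_le_of_continuous hbdd hf
  have : IsFiniteMeasure (volume.restrict Ω) := ⟨by
    rw [Measure.restrict_apply_univ]; exact hbdd.measure_lt_top⟩
  exact MemLp.of_bound hf.aestronglyMeasurable C
    (ae_restrict_of_forall_mem hopen.measurableSet hC)

theorem continuous_fderiv_apply_const {f : Plane → ℂ} (hf : ContDiff ℝ 1 f) (v : Plane) :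
    Continuous fun x => fderiv ℝ f x v :=
  (hf.continuous_fderiv one_ne_zero).clm_apply continuous_const

theorem setIntegral_fderiv_mul_eq_neg {f : Plane → ℂ} (hf : ContDiff ℝ 1 f) (v : Plane)
    {φ : Plane → ℝ} (hφ : ContDiff ℝ ∞ φ) (hc : HasCompactSupport φ) (hs : tsupport φ ⊆ Ω) :
    ∫ x in Ω, ((fderiv ℝ φ x v : ℝ) : ℂ) * f x =
      - ∫ x in Ω, ((φ x : ℝ) : ℂ) * fderiv ℝ f x v := by
  have hφ' : Continuous fun x => fderiv ℝ φ x v :=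
    (hφ.continuous_fderiv (by simp)).clm_apply continuous_const
  have hc' : HasCompactSupport fun x => fderiv ℝ φ x v := hc.fderiv_apply ℝ v
  have hz : ∀ x, x ∉ Ω → φ x = 0 := fun x hx =>
    image_eq_zero_of_notMem_tsupport fun h => hx (hs h)
  have hz' : ∀ x, x ∉ Ω → fderiv ℝ φ x v = 0 := fun x hx => by
    rw [fderiv_of_notMem_tsupport ℝ fun h => hx (hs h), zero_apply]
  rw [setIntegral_eq_integral_of_forall_compl_eq_zero fun x hx => by simp [hz' x hx],
    setIntegral_eq_integral_of_forall_compl_eq_zero fun x hx => by simp [hz x hx]]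
  simp only [← Complex.real_smul]
  rw [integral_smul_fderiv_eq_neg_fderiv_smul_of_integrable (𝕜 := ℝ), neg_neg]
  · exact (hφ'.smul hf.continuous).integrable_of_hasCompactSupport hc'.smul_right
  · exact (hφ.continuous.smul (continuous_fderiv_apply_const hf v)).integrable_of_hasCompactSupport
      hc.smul_right
  · exact (hφ.continuous.smul hf.continuous).integrable_of_hasCompactSupport hc.smul_right
  · exact fun x _ => (hφ.differentiable (by simp)).differentiableAt
  · exact fun x _ => (hf.differentiable one_ne_zero).differentiableAt

/-- The restriction of a continuously differentiable function to a bounded open set, as an element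
of `H¹`. -/
noncomputable def H1.ofContDiff (hopen : IsOpen Ω) (hbdd : Bornology.IsBounded Ω) {f : Plane → ℂ}
    (hf : ContDiff ℝ 1 f) : H1 Ω where
  toL2 := (memLp_restrict_of_continuous hopen hbdd hf.continuous).toLp f
  grad i := (memLp_restrict_of_continuous hopen hbdd
    (continuous_fderiv_apply_const hf (EuclideanSpace.single i 1))).toLp _
  hasWeakPartial i φ hφ hc hs := by
    have h1 := (memLp_restrict_of_continuous hopen hbdd hf.continuous).coeFn_toLp
    have h2 := (memLp_restrict_of_continuous hopen hbdd
      (continuous_fderiv_apply_const hf (EuclideanSpace.single i 1))).coeFn_toLp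
    rw [integral_congr_ae (h1.mono fun x hx => congrArg (_ * ·) hx),
      integral_congr_ae (h2.mono fun x hx => congrArg (_ * ·) hx)]
    exact setIntegral_fderiv_mul_eq_neg hf _ hφ hc hs

theorem H1.coeFn_ofContDiff (hopen : IsOpen Ω) (hbdd : Bornology.IsBounded Ω) {f : Plane → ℂ}
    (hf : ContDiff ℝ 1 f) : (H1.ofContDiff hopen hbdd hf).toL2 =ᵐ[volume.restrict Ω] f :=
  (memLp_restrict_of_continuous hopen hbdd hf.continuous).coeFn_toLp

theorem H1.magneticGrad_ofContDiff (hopen : IsOpen Ω) (hbdd : Bornology.IsBounded Ω)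
    {f : Plane → ℂ} (hf : ContDiff ℝ 1 f) (β : ℝ) (i : Fin 2) :
    magneticGradL2 hopen hbdd β (H1.ofContDiff hopen hbdd hf) i =ᵐ[volume.restrict Ω]
      fun x => fderiv ℝ f x (EuclideanSpace.single i 1) - Complex.I * f x * potential β x i := by
  have h1 := H1.coeFn_ofContDiff hopen hbdd hf
  have h2 := (memLp_restrict_of_continuous hopen hbdd
      (continuous_fderiv_apply_const hf (EuclideanSpace.single i 1))).coeFn_toLp
  have h3 := (memLp_magneticGrad hopen hbdd β (H1.ofContDiff hopen hbdd hf) i).coeFn_toLp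
  filter_upwards [h1, h2, h3] with x h1 h2 h3
  exact h3.trans (congrArg₂ (fun a b => a - Complex.I * b * (potential β x i : ℂ)) h2 h1)

theorem ofReal_norm_sq_eq_lintegral {X : Type*} [MeasurableSpace X] {μ : Measure X}
    (u : Lp ℂ 2 μ) : ENNReal.ofReal (‖u‖ ^ 2) = ∫⁻ x, ENNReal.ofReal (‖u x‖ ^ 2) ∂μ := by
  have h1 : Integrable (fun x => ‖u x‖ ^ 2) μ := by
    exact (memLp_two_iff_integrable_sq_norm (Lp.aestronglyMeasurable u)).1 (Lp.memLp u)
  rw [← ofReal_integral_eq_lintegral_ofReal h1 (Eventually.of_forall fun x => sq_nonneg _)]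
  congr 1
  rw [← inner_self_eq_norm_sq (𝕜 := ℂ), L2.inner_def]
  simp only [inner_self_eq_norm_sq_to_K]
  have h2 := integral_ofReal (𝕜 := ℂ) (μ := μ) (f := fun x => ‖u x‖ ^ 2)
  push_cast at h2 ⊢
  rw [h2]
  simp

/-- The argument of the Hermite functions in the Landau gauge. -/
noncomputable def landauArg (β ξ y : ℝ) : ℝ := Real.sqrt (2 * β) * (y + ξ / β)

/-- Generalised eigenfunctions of the Landau Hamiltonian on the plane. -/
noncomputable def landauFun (β : ℝ) (m : ℕ) (ξ : ℝ) (x : Plane) : ℂ :=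
  Complex.exp (Complex.I * (β / 2 * (x 0 * x 1) + ξ * x 0 : ℝ)) *
    (hermiteFun m (landauArg β ξ (x 1)) : ℂ)

theorem hasFDerivAt_coord (i : Fin 2) (x : Plane) :
    HasFDerivAt (fun x : Plane => x i) (EuclideanSpace.proj i : Plane →L[ℝ] ℝ) x :=
  (EuclideanSpace.proj i : Plane →L[ℝ] ℝ).hasFDerivAt

theorem contDiff_hermiteFun (m : ℕ) : ContDiff ℝ 1 (hermiteFun m) := by
  rw [contDiff_one_iff_deriv]
  refine ⟨fun s => (hasDerivAt_hermiteFun m s).differentiableAt, ?_⟩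
  rw [funext fun s => (hasDerivAt_hermiteFun m s).deriv]
  exact continuous_hermiteFunDeriv m

theorem contDiff_landauFun (β : ℝ) (m : ℕ) (ξ : ℝ) : ContDiff ℝ 1 (landauFun β m ξ) := by
  have h : ∀ i : Fin 2, ContDiff ℝ 1 fun x : Plane => x i := fun i =>
    (EuclideanSpace.proj i : Plane →L[ℝ] ℝ).contDiff
  have h1 : ContDiff ℝ 1 fun x : Plane => (β / 2 * (x 0 * x 1) + ξ * x 0 : ℝ) :=
    (contDiff_const.mul ((h 0).mul (h 1))).add (contDiff_const.mul (h 0))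
  have h2 : ContDiff ℝ 1 fun x : Plane => landauArg β ξ (x 1) :=
    contDiff_const.mul ((h 1).add contDiff_const)
  exact (contDiff_const.mul (Complex.ofRealCLM.contDiff.comp h1)).cexp.mul
    (Complex.ofRealCLM.contDiff.comp ((contDiff_hermiteFun m).comp h2))

theorem fderiv_landauFun_apply (β : ℝ) (m : ℕ) (ξ : ℝ) (x : Plane) (v : Plane) :
    fderiv ℝ (landauFun β m ξ) x v =
      Complex.exp (Complex.I * (β / 2 * (x 0 * x 1) + ξ * x 0 : ℝ)) *
        (Complex.I * (β / 2 * (x 0 * v 1 + x 1 * v 0) + ξ * v 0 : ℝ) *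
            hermiteFun m (landauArg β ξ (x 1)) +
          (hermiteFunDeriv m (landauArg β ξ (x 1)) * (Real.sqrt (2 * β) * v 1) : ℝ)) := by
  have h := hasFDerivAt_coord
  have h1 := (((h 0 x).mul (h 1 x)).const_mul (β / 2)).add ((h 0 x).const_mul ξ)
  have h2 := ((h 1 x).add_const (ξ / β)).const_mul (Real.sqrt (2 * β))
  have h3 := ((Complex.ofRealCLM.hasFDerivAt.comp x h1).const_mul Complex.I).cexp
  have h4 := Complex.ofRealCLM.hasFDerivAt.comp x
    ((hasDerivAt_hermiteFun m _).comp_hasFDerivAt x h2)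
  have h5 := (h3.mul h4).fderiv
  change fderiv ℝ (landauFun β m ξ) x = _ at h5
  rw [h5]
  simp [landauArg]
  ring

/-- The squared norm of the magnetic gradient of a Landau function. -/
theorem sum_norm_magneticGrad_landauFun {β : ℝ} (hβ : 0 < β) (m : ℕ) (ξ : ℝ) (x : Plane) :
    ∑ i, ‖fderiv ℝ (landauFun β m ξ) x (EuclideanSpace.single i 1) -
        Complex.I * landauFun β m ξ x * potential β x i‖ ^ 2 =
      2 * β * hermiteEnergy m (landauArg β ξ (x 1)) := by
  have hs := Real.sq_sqrt (by positivity : 0 ≤ 2 * β)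
  set E := Complex.exp (Complex.I * (β / 2 * (x 0 * x 1) + ξ * x 0 : ℝ)) with hE
  have hE1 : ‖E‖ = 1 := by rw [hE, mul_comm, Complex.norm_exp_ofReal_mul_I]
  -- The phase βx₁x₂/2 gauges the potential to (−βx₂, 0), so the first component only multiplies by
  -- βx₂ + ξ and the second only differentiates the profile.
  have h0 : fderiv ℝ (landauFun β m ξ) x (EuclideanSpace.single 0 1) -
      Complex.I * landauFun β m ξ x * potential β x 0 =
      E * Complex.I * ((β * x 1 + ξ) * hermiteFun m (landauArg β ξ (x 1)) : ℝ) := by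
    rw [fderiv_landauFun_apply, landauFun, ← hE]
    simp [potential]
    ring
  have h1 : fderiv ℝ (landauFun β m ξ) x (EuclideanSpace.single 1 1) -
      Complex.I * landauFun β m ξ x * potential β x 1 =
      E * (hermiteFunDeriv m (landauArg β ξ (x 1)) * Real.sqrt (2 * β) : ℝ) := by
    rw [fderiv_landauFun_apply, landauFun, ← hE]
    simp [potential]
    ring
  rw [Fin.sum_univ_two, h0, h1]
  simp only [norm_mul, hE1, Complex.norm_I, Complex.norm_real, one_mul, Real.norm_eq_abs, mul_pow,
    sq_abs, hs, hermiteEnergy]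
  have h2 : (β * x 1 + ξ) ^ 2 = 2 * β * (landauArg β ξ (x 1) / 2) ^ 2 := by
    rw [landauArg, div_pow, mul_pow, hs]
    field_simp
  rw [h2]
  ring

theorem norm_landauFun_sq (β : ℝ) (m : ℕ) (ξ : ℝ) (x : Plane) :
    ‖landauFun β m ξ x‖ ^ 2 =
      hermiteFun m (landauArg β ξ (x 1)) * hermiteFun m (landauArg β ξ (x 1)) := by
  rw [landauFun, norm_mul, mul_comm Complex.I, Complex.norm_exp_ofReal_mul_I, one_mul,
    Complex.norm_real, Real.norm_eq_abs, sq_abs, sq]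

/-- The Landau functions as elements of `H¹(Ω)`. -/
noncomputable def landauH1 (hopen : IsOpen Ω) (hbdd : Bornology.IsBounded Ω) (β : ℝ) (m : ℕ)
    (ξ : ℝ) : H1 Ω := H1.ofContDiff hopen hbdd (contDiff_landauFun β m ξ)

theorem ofReal_norm_landauH1_sq (hopen : IsOpen Ω) (hbdd : Bornology.IsBounded Ω) (β : ℝ) (m : ℕ)
    (ξ : ℝ) : ENNReal.ofReal (‖(landauH1 hopen hbdd β m ξ).toL2‖ ^ 2) =
      ∫⁻ x in Ω, ENNReal.ofReal
        (hermiteFun m (landauArg β ξ (x 1)) * hermiteFun m (landauArg β ξ (x 1))) := by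
  rw [ofReal_norm_sq_eq_lintegral]
  refine lintegral_congr_ae ?_
  filter_upwards [H1.coeFn_ofContDiff hopen hbdd (contDiff_landauFun β m ξ)] with x hx
  rw [landauH1, hx, norm_landauFun_sq]

theorem ofReal_norm_magneticGradL2_landauH1_sq (hopen : IsOpen Ω) (hbdd : Bornology.IsBounded Ω)
    {β : ℝ} (hβ : 0 < β) (m : ℕ) (ξ : ℝ) :
    ENNReal.ofReal (‖magneticGradL2 hopen hbdd β (landauH1 hopen hbdd β m ξ)‖ ^ 2) =
      ∫⁻ x in Ω, ENNReal.ofReal (2 * β * hermiteEnergy m (landauArg β ξ (x 1))) := by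
  have h := fun i => H1.magneticGrad_ofContDiff hopen hbdd (contDiff_landauFun β m ξ) β i
  rw [PiLp.norm_sq_eq_of_L2, ENNReal.ofReal_sum_of_nonneg fun i _ => sq_nonneg _]
  simp only [ofReal_norm_sq_eq_lintegral]
  rw [← lintegral_finsetSum' _ fun i _ =>
    ((Lp.aestronglyMeasurable _).norm.aemeasurable.pow_const 2).ennreal_ofReal]
  refine lintegral_congr_ae ?_
  filter_upwards [ae_all_iff.2 h] with x hx
  rw [← ENNReal.ofReal_sum_of_nonneg fun i _ => sq_nonneg _,
    ← sum_norm_magneticGrad_landauFun hβ]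
  simp only [landauH1, hx]

theorem sqrt_two_mul_div {β : ℝ} (hβ : 0 < β) :
    (Real.sqrt (2 * β) / β)⁻¹ = Real.sqrt (β / 2) := by
  rw [inv_div, eq_comm, Real.sqrt_eq_iff_mul_self_eq (by positivity) (by positivity),
    div_mul_div_comm, Real.mul_self_sqrt (by positivity)]
  field_simp

theorem landauArg_eq (β ξ y : ℝ) :
    landauArg β ξ y = Real.sqrt (2 * β) / β * ξ + Real.sqrt (2 * β) * y := by
  rw [landauArg]
  ring

/-- `landauArg` is affine in ξ with slope √(2β)/β, so the position y is only a translation and drops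
out. -/
theorem lintegral_comp_landauArg {β : ℝ} (hβ : 0 < β) {F : ℝ → ℝ} (hF : Integrable F)
    (hpos : ∀ s, 0 ≤ F s) (y : ℝ) :
    ∫⁻ ξ, ENNReal.ofReal (F (landauArg β ξ y)) = ENNReal.ofReal (Real.sqrt (β / 2) * ∫ s, F s) := by
  simp only [landauArg_eq]
  have ha : 0 < Real.sqrt (2 * β) / β := by positivity
  have hF' := hF.comp_add_right (Real.sqrt (2 * β) * y)
  rw [← ofReal_integral_eq_lintegral_ofReal (hF'.comp_mul_left' ha.ne')
    (Eventually.of_forall fun _ => hpos _)]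
  rw [Measure.integral_comp_mul_left (fun s => F (s + Real.sqrt (2 * β) * y)),
    integral_add_right_eq_self, sqrt_two_mul_div hβ, abs_of_nonneg (Real.sqrt_nonneg _),
    smul_eq_mul]

theorem lintegral_lintegral_comp_landauArg {β : ℝ} (hβ : 0 < β) {F : ℝ → ℝ} (hF : Integrable F)
    (hc : Continuous F) (hpos : ∀ s, 0 ≤ F s) :
    ∫⁻ ξ, ∫⁻ x in Ω, ENNReal.ofReal (F (landauArg β ξ (x 1))) =
      ENNReal.ofReal (Real.sqrt (β / 2) * ∫ s, F s) * volume Ω := by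
  rw [lintegral_lintegral_swap]
  · simp only [lintegral_comp_landauArg hβ hF hpos, lintegral_const, Measure.restrict_apply_univ]
  · refine Measurable.aemeasurable (ENNReal.measurable_ofReal.comp
      (Continuous.measurable (hc.comp ?_)))
    unfold landauArg
    fun_prop

theorem continuous_hermiteEnergy (m : ℕ) : Continuous (hermiteEnergy m) := by
  have h1 := continuous_hermiteFun m
  have h2 := continuous_hermiteFunDeriv m
  unfold hermiteEnergy
  fun_prop

theorem lintegral_norm_landauH1_sq (hopen : IsOpen Ω) (hbdd : Bornology.IsBounded Ω) {β : ℝ}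
    (hβ : 0 < β) (m : ℕ) :
    ∫⁻ ξ, ENNReal.ofReal (‖(landauH1 hopen hbdd β m ξ).toL2‖ ^ 2) =
      ENNReal.ofReal (Real.sqrt (β / 2)) * volume Ω := by
  simp only [ofReal_norm_landauH1_sq]
  rw [lintegral_lintegral_comp_landauArg hβ (integrable_hermiteFun_mul m m)
    ((continuous_hermiteFun m).mul (continuous_hermiteFun m)) fun s => mul_self_nonneg _,
    integral_hermiteFun_mul, if_pos rfl, mul_one]

theorem lintegral_norm_magneticGradL2_landauH1_sq (hopen : IsOpen Ω)
    (hbdd : Bornology.IsBounded Ω) {β : ℝ} (hβ : 0 < β) (m : ℕ) :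
    ∫⁻ ξ, ENNReal.ofReal (‖magneticGradL2 hopen hbdd β (landauH1 hopen hbdd β m ξ)‖ ^ 2) =
      ENNReal.ofReal (Real.sqrt (β / 2) * (β * (2 * m + 1))) * volume Ω := by
  simp only [ofReal_norm_magneticGradL2_landauH1_sq hopen hbdd hβ]
  rw [lintegral_lintegral_comp_landauArg hβ ((integrable_hermiteEnergy m).const_mul (2 * β))
    (continuous_const.mul (continuous_hermiteEnergy m)) fun s => by
      unfold hermiteEnergy; positivity,
    integral_const_mul, integral_hermiteEnergy]
  congr 3
  ring

end TestFunctions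

/-! ### A continuous Bessel inequality for the Landau functions. -/

section Bessel

theorem sum_norm_inner_sq_le_of_orthogonal {H ι : Type*} [DecidableEq ι] [NormedAddCommGroup H]
    [InnerProductSpace ℂ H] {v : ι → H} {C : ℝ} (hC : 0 < C)
    (hv : ∀ i j, inner ℂ (v i) (v j) = if i = j then (C : ℂ) else 0) (x : H) (s : Finset ι) :
    ∑ i ∈ s, ‖inner ℂ (v i) x‖ ^ 2 ≤ C * ‖x‖ ^ 2 := by
  have hs := Real.sq_sqrt hC.le
  have hs0 := Real.sqrt_pos.2 hC
  have ho : Orthonormal ℂ fun i => ((Real.sqrt C)⁻¹ : ℂ) • v i := by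
    rw [orthonormal_iff_ite]
    intro i j
    rw [inner_smul_left, inner_smul_right, hv]
    split_ifs
    · rw [← Complex.ofReal_inv, Complex.conj_ofReal]
      norm_cast
      nth_rewrite 3 [← hs]
      field_simp
    · simp
  have h := ho.sum_inner_products_le x (s := s)
  have h2 : ∀ i, ‖inner ℂ (((Real.sqrt C)⁻¹ : ℂ) • v i) x‖ ^ 2 =
      C⁻¹ * ‖inner ℂ (v i) x‖ ^ 2 := by
    intro i
    rw [inner_smul_left, norm_mul, mul_pow, RCLike.norm_conj, norm_inv, Complex.norm_real,
      Real.norm_eq_abs, inv_pow, sq_abs, hs]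
  simp only [h2] at h
  rw [← Finset.mul_sum, inv_mul_le_iff₀ hC] at h
  exact h

/-- The coordinates of a point of the plane, as a pair. -/
def toPair (x : Plane) : ℝ × ℝ := (x 0, x 1)

theorem measurePreserving_toPair : MeasurePreserving toPair :=
  (volume_preserving_finTwoArrow ℝ).comp (PiLp.volume_preserving_ofLp (Fin 2))

theorem measurableEmbedding_toPair : MeasurableEmbedding toPair :=
  MeasurableEquiv.finTwoArrow.measurableEmbedding.comp
    (MeasurableEquiv.toLp 2 (Fin 2 → ℝ)).symm.measurableEmbedding

/-- A vertical strip in the plane. -/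
def strip (L : ℝ) : Set Plane := toPair ⁻¹' (Ioc (-L) L ×ˢ univ)

theorem setIntegral_strip_mul {L : ℝ} (hL : -L ≤ L) (f g : ℝ → ℂ) :
    ∫ x in strip L, f (x 0) * g (x 1) = (∫ t in -L..L, f t) * ∫ t, g t := by
  have h := measurePreserving_toPair.setIntegral_preimage_emb measurableEmbedding_toPair
    (fun z => f z.1 * g z.2) (Ioc (-L) L ×ˢ univ)
  rw [Measure.volume_eq_prod, setIntegral_prod_mul, setIntegral_univ] at h
  rw [intervalIntegral.integral_of_le hL, ← h]
  rfl

theorem integrableOn_strip (L : ℝ) {g : ℝ → ℝ} (hg : Integrable g) :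
    IntegrableOn (fun x : Plane => g (x 1)) (strip L) := by
  have h : IntegrableOn (fun z : ℝ × ℝ => (1 : ℝ) * g z.2) (Ioc (-L) L ×ˢ univ) := by
    rw [IntegrableOn, Measure.volume_eq_prod, ← Measure.prod_restrict, Measure.restrict_univ]
    exact (integrable_const (1 : ℝ)).mul_prod hg
  refine ((measurePreserving_toPair.integrableOn_comp_preimage measurableEmbedding_toPair).2
    h).congr (Eventually.of_forall fun x => ?_)
  exact one_mul _

theorem integral_exp_frequency {L : ℝ} (hL : 0 < L) (n : ℤ) :
    ∫ t in -L..L, Complex.exp (Complex.I * (n * (Real.pi / L) * t : ℝ)) =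
      if n = 0 then ((2 * L : ℝ) : ℂ) else 0 := by
  split_ifs with hn
  · subst hn
    simp
    ring
  · have hL' : (L : ℂ) ≠ 0 := by exact_mod_cast hL.ne'
    have hpi : (Real.pi : ℂ) ≠ 0 := by exact_mod_cast Real.pi_ne_zero
    have hn' : (n : ℂ) ≠ 0 := by exact_mod_cast hn
    have hc : Complex.I * (n * (Real.pi / L)) ≠ 0 :=
      mul_ne_zero Complex.I_ne_zero (mul_ne_zero hn' (div_ne_zero hpi hL'))
    have h := integral_exp_mul_complex (a := -L) (b := L) hc
    have h1 : Complex.exp (Complex.I * (n * (Real.pi / L)) * (L : ℝ)) =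
        Complex.exp (Complex.I * (n * (Real.pi / L)) * (-L : ℝ)) := by
      rw [Complex.exp_eq_exp_iff_exists_int]
      refine ⟨n, ?_⟩
      push_cast
      field_simp
      ring
    rw [h1, sub_self, zero_div] at h
    rw [← h]
    refine intervalIntegral.integral_congr fun t _ => ?_
    push_cast
    congr 1
    ring

theorem integrable_comp_landauArg {β : ℝ} (hβ : 0 < β) {F : ℝ → ℝ} (hF : Integrable F) (ξ : ℝ) :
    Integrable fun y => F (landauArg β ξ y) := by
  have ha : 0 < Real.sqrt (2 * β) := by positivity
  exact (hF.comp_mul_left' ha.ne').comp_add_right (ξ / β)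

theorem integral_comp_landauArg {β : ℝ} (F : ℝ → ℝ) (ξ : ℝ) :
    ∫ y, F (landauArg β ξ y) = (Real.sqrt (2 * β))⁻¹ * ∫ s, F s := by
  unfold landauArg
  rw [integral_add_right_eq_self (fun y => F (Real.sqrt (2 * β) * y)),
    Measure.integral_comp_mul_left, abs_of_nonneg (by positivity), smul_eq_mul]

theorem memLp_landauFun_strip {β : ℝ} (hβ : 0 < β) (m : ℕ) (ξ L : ℝ) :
    MemLp (landauFun β m ξ) 2 (volume.restrict (strip L)) := by
  rw [memLp_two_iff_integrable_sq_norm (contDiff_landauFun β m ξ).continuous.aestronglyMeasurable]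
  simp only [norm_landauFun_sq]
  exact integrableOn_strip L (integrable_comp_landauArg hβ (integrable_hermiteFun_mul m m) ξ)

/-- Frequencies spaced by π/L are orthogonal over a period of length 2L. When they agree, the
Hermite profiles share a centre and their own orthogonality separates the levels. -/
theorem integral_landauFun_mul_conj {β : ℝ} (m m' : ℕ) {L : ℝ} (hL : 0 < L) (θ : ℝ) (n n' : ℤ) :
    ∫ x in strip L, landauFun β m' (θ + n' * (Real.pi / L)) x *
        conj (landauFun β m (θ + n * (Real.pi / L)) x) =
      if (m, n) = (m', n') then ((2 * L / Real.sqrt (2 * β) : ℝ) : ℂ) else 0 := by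
  have h : ∀ x : Plane, landauFun β m' (θ + n' * (Real.pi / L)) x *
        conj (landauFun β m (θ + n * (Real.pi / L)) x) =
      Complex.exp (Complex.I * ((n' - n : ℤ) * (Real.pi / L) * x 0 : ℝ)) *
        ((hermiteFun m (landauArg β (θ + n * (Real.pi / L)) (x 1)) *
          hermiteFun m' (landauArg β (θ + n' * (Real.pi / L)) (x 1)) : ℝ) : ℂ) := by
    intro x
    rw [landauFun, landauFun, map_mul, ← Complex.exp_conj, Complex.conj_ofReal, map_mul,
      Complex.conj_I, Complex.conj_ofReal, mul_mul_mul_comm, ← Complex.exp_add]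
    push_cast
    congr 1
    · congr 1
      ring
    · ring
  simp only [h]
  rw [setIntegral_strip_mul (by linarith)
    (fun t => Complex.exp (Complex.I * ((n' - n : ℤ) * (Real.pi / L) * t : ℝ)))
    (fun y => ((hermiteFun m (landauArg β (θ + n * (Real.pi / L)) y) *
          hermiteFun m' (landauArg β (θ + n' * (Real.pi / L)) y) : ℝ) : ℂ)),
    integral_exp_frequency hL]
  by_cases hn : n = n'
  · subst hn
    rw [integral_complex_ofReal,
      integral_comp_landauArg (fun s => hermiteFun m s * hermiteFun m' s),
      integral_hermiteFun_mul]
    by_cases hm : m = m'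
    · simp [hm, div_eq_mul_inv]
    · simp [hm]
  · rw [if_neg (sub_ne_zero.2 (Ne.symm hn)), zero_mul, if_neg]
    exact fun h => hn (Prod.ext_iff.1 h).2

variable {Ω : Set Plane}

theorem inner_landauH1 (hopen : IsOpen Ω) (hbdd : Bornology.IsBounded Ω) (β : ℝ) (m : ℕ) (ξ : ℝ)
    (e : L2 Ω) : inner ℂ e (landauH1 hopen hbdd β m ξ).toL2 =
      ∫ x in Ω, landauFun β m ξ x * conj (e x) := by
  refine integral_congr_ae ?_
  filter_upwards [H1.coeFn_ofContDiff hopen hbdd (contDiff_landauFun β m ξ)] with x hx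
  rw [RCLike.inner_apply, landauH1, hx]

theorem sum_norm_inner_landauH1_sq_le (hopen : IsOpen Ω) (hbdd : Bornology.IsBounded Ω) {β : ℝ}
    (hβ : 0 < β) {L : ℝ} (hL : 0 < L) (hsub : Ω ⊆ strip L) (e : L2 Ω) (θ : ℝ)
    (s : Finset (ℕ × ℤ)) :
    ∑ p ∈ s, ‖inner ℂ e (landauH1 hopen hbdd β p.1 (θ + p.2 * (Real.pi / L))).toL2‖ ^ 2 ≤
      2 * L / Real.sqrt (2 * β) * ‖e‖ ^ 2 := by
  have hr : (volume.restrict (strip L)).restrict Ω = volume.restrict Ω := by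
    rw [Measure.restrict_restrict hopen.measurableSet, inter_eq_left.2 hsub]
  -- Extending `e` by zero to the strip keeps its norm and its inner products, and on the strip the
  -- Landau functions are orthogonal.
  have hmem : MemLp (Ω.indicator e) 2 (volume.restrict (strip L)) := by
    rw [memLp_indicator_iff_restrict hopen.measurableSet, hr]
    exact Lp.memLp e
  have hnorm : ‖hmem.toLp‖ = ‖e‖ := by
    rw [Lp.norm_toLp, eLpNorm_indicator_eq_eLpNorm_restrict hopen.measurableSet, hr, Lp.norm_def]
  let v : ℕ × ℤ → Lp ℂ 2 (volume.restrict (strip L)) := fun p =>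
    (memLp_landauFun_strip hβ p.1 (θ + p.2 * (Real.pi / L)) L).toLp _
  have hv : ∀ p q, inner ℂ (v p) (v q) =
      if p = q then ((2 * L / Real.sqrt (2 * β) : ℝ) : ℂ) else 0 := by
    intro p q
    rw [← integral_landauFun_mul_conj p.1 q.1 hL θ p.2 q.2, L2.inner_def]
    refine integral_congr_ae ?_
    filter_upwards [(memLp_landauFun_strip hβ p.1 (θ + p.2 * (Real.pi / L)) L).coeFn_toLp,
      (memLp_landauFun_strip hβ q.1 (θ + q.2 * (Real.pi / L)) L).coeFn_toLp] with x hp hq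
    rw [RCLike.inner_apply, hp, hq]
  have hinner : ∀ p : ℕ × ℤ,
      inner ℂ e (landauH1 hopen hbdd β p.1 (θ + p.2 * (Real.pi / L))).toL2 =
        inner ℂ hmem.toLp (v p) := by
    intro p
    have hset : ∀ f : Plane → ℂ, ∫ x in Ω, f x = ∫ x in strip L, Ω.indicator f x := fun f => by
      rw [integral_indicator hopen.measurableSet, hr]
    rw [inner_landauH1, L2.inner_def, hset]
    refine integral_congr_ae ?_
    filter_upwards [hmem.coeFn_toLp,
      (memLp_landauFun_strip hβ p.1 (θ + p.2 * (Real.pi / L)) L).coeFn_toLp] with x hx hp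
    rw [RCLike.inner_apply, hx, hp]
    by_cases hxΩ : x ∈ Ω
    · rw [indicator_of_mem hxΩ, indicator_of_mem hxΩ]
    · simp [indicator_of_notMem hxΩ]
  have hmain := sum_norm_inner_sq_le_of_orthogonal (by positivity) hv hmem.toLp s
  rw [hnorm] at hmain
  refine (Finset.sum_congr rfl fun p _ => ?_).trans_le hmain
  rw [hinner, norm_inner_symm]

theorem measurable_inner_landauH1 (hopen : IsOpen Ω) (hbdd : Bornology.IsBounded Ω) (β : ℝ)
    (m : ℕ) (e : L2 Ω) :
    Measurable fun ξ => ENNReal.ofReal (‖inner ℂ e (landauH1 hopen hbdd β m ξ).toL2‖ ^ 2) := by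
  simp only [inner_landauH1]
  have hc : Continuous fun z : ℝ × Plane => landauFun β m z.1 z.2 := by
    have := continuous_hermiteFun m
    unfold landauFun landauArg
    fun_prop
  have h2 : StronglyMeasurable
      (Function.uncurry fun (ξ : ℝ) (x : Plane) => landauFun β m ξ x * conj (e x)) :=
    hc.stronglyMeasurable.mul (Complex.continuous_conj.comp_stronglyMeasurable
      ((Lp.stronglyMeasurable e).comp_measurable measurable_snd))
  exact (h2.integral_prod_right.norm.measurable.pow_const 2).ennreal_ofReal

theorem lintegral_eq_lintegral_tsum_translates {δ : ℝ} (hδ : 0 < δ) {c : ℝ → ENNReal}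
    (hc : Measurable c) : ∫⁻ ξ, c ξ = ∫⁻ θ in Ioc 0 δ, ∑' n : ℤ, c (θ + n * δ) := by
  rw [lintegral_tsum fun n : ℤ =>
    (show Measurable fun θ => c (θ + n * δ) from hc.comp (measurable_add_const _)).aemeasurable]
  rw [← setLIntegral_univ, ← iUnion_Ioc_add_zsmul hδ 0,
    lintegral_iUnion (fun _ => measurableSet_Ioc) (pairwise_disjoint_Ioc_add_zsmul 0 δ)]
  refine tsum_congr fun n => ?_
  have h := (measurePreserving_add_right volume ((n : ℝ) * δ)).setLIntegral_comp_preimage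
    (measurableSet_Ioc (a := 0 + n • δ) (b := 0 + (n + 1) • δ)) hc
  rw [← h]
  congr 2
  ext x
  simp [add_mul]

/-- The ξ-line is cut into cosets θ + (π/L)ℤ. Each obeys the discrete Bessel bound 2L/√(2β), and θ
runs over an interval of length π/L, so the auxiliary width L cancels. -/
theorem lintegral_sum_inner_landauH1_le (hopen : IsOpen Ω) (hbdd : Bornology.IsBounded Ω) {β : ℝ}
    (hβ : 0 < β) (e : L2 Ω) (M : ℕ) :
    ∫⁻ ξ, ∑ m ∈ Finset.range M,
        ENNReal.ofReal (‖inner ℂ e (landauH1 hopen hbdd β m ξ).toL2‖ ^ 2) ≤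
      ENNReal.ofReal (2 * Real.pi / Real.sqrt (2 * β) * ‖e‖ ^ 2) := by
  obtain ⟨L, hL, hsub⟩ : ∃ L : ℝ, 0 < L ∧ Ω ⊆ strip L := by
    obtain ⟨C, hC⟩ := exists_norm_le_of_continuous (f := fun x : Plane => x 0) hbdd (by fun_prop)
    refine ⟨|C| + 1, by positivity, fun x hx => ⟨?_, mem_univ _⟩⟩
    have h := (hC x hx).trans (le_abs_self C)
    rw [Real.norm_eq_abs, abs_le] at h
    exact ⟨by change _ < x 0; linarith [h.1], by change x 0 ≤ _; linarith [h.2]⟩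
  have hδ : 0 < Real.pi / L := by positivity
  rw [lintegral_eq_lintegral_tsum_translates hδ
    (Finset.measurable_fun_sum _ fun m _ => measurable_inner_landauH1 hopen hbdd β m e)]
  have hbound : ∀ θ : ℝ, ∑' n : ℤ, ∑ m ∈ Finset.range M, ENNReal.ofReal
      (‖inner ℂ e (landauH1 hopen hbdd β m (θ + n * (Real.pi / L))).toL2‖ ^ 2) ≤
        ENNReal.ofReal (2 * L / Real.sqrt (2 * β) * ‖e‖ ^ 2) := by
    intro θ
    rw [ENNReal.tsum_eq_iSup_sum]
    refine iSup_le fun s => ?_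
    rw [Finset.sum_comm, ← Finset.sum_product' (f := fun m (n : ℤ) => ENNReal.ofReal
      (‖inner ℂ e (landauH1 hopen hbdd β m (θ + n * (Real.pi / L))).toL2‖ ^ 2)),
      ← ENNReal.ofReal_sum_of_nonneg fun i _ => sq_nonneg _]
    exact ENNReal.ofReal_le_ofReal
      (sum_norm_inner_landauH1_sq_le hopen hbdd hβ hL hsub e θ _)
  refine (lintegral_mono hbound).trans_eq ?_
  rw [lintegral_const, Measure.restrict_apply_univ, Real.volume_Ioc,
    ← ENNReal.ofReal_mul (by positivity)]
  congr 1
  field_simp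
  ring

end Bessel

/-! ### Averaging over Landau levels and optimising their number. -/

section Averaging

variable {Ω : Set Plane}

theorem IsWeakSolution.nonneg_of_hilbertBasis (hopen : IsOpen Ω) (hbdd : Bornology.IsBounded Ω)
    {β : ℝ} {lam : ℕ → ℝ} {e : HilbertBasis ℕ ℂ (L2 Ω)}
    (he : ∀ j, IsWeakSolution Ω β (lam j) (e j)) (j : ℕ) : 0 ≤ lam j :=
  (he j).nonneg hopen hbdd (e.orthonormal.ne_zero j)

theorem lintegral_variational_inequality (hopen : IsOpen Ω) (hbdd : Bornology.IsBounded Ω) {β : ℝ}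
    (hβ : 0 < β) {lam : ℕ → ℝ} {e : HilbertBasis ℕ ℂ (L2 Ω)} (hlam : Monotone lam)
    (he : ∀ j, IsWeakSolution Ω β (lam j) (e j)) (k m : ℕ) :
    ENNReal.ofReal (lam k) * (ENNReal.ofReal (Real.sqrt (β / 2)) * volume Ω) ≤
      ENNReal.ofReal (Real.sqrt (β / 2) * (β * (2 * m + 1))) * volume Ω +
        ∑ j ∈ Finset.range k, ENNReal.ofReal (lam k) *
          ∫⁻ ξ, ENNReal.ofReal (‖inner ℂ (e j) (landauH1 hopen hbdd β m ξ).toL2‖ ^ 2) := by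
  have hnn := IsWeakSolution.nonneg_of_hilbertBasis hopen hbdd he
  have hm := fun j => (measurable_inner_landauH1 hopen hbdd β m (e j)).const_mul
    (ENNReal.ofReal (lam k))
  rw [← lintegral_norm_landauH1_sq hopen hbdd hβ m,
    ← lintegral_norm_magneticGradL2_landauH1_sq hopen hbdd hβ m,
    ← lintegral_const_mul' _ _ ENNReal.ofReal_ne_top]
  simp only [← lintegral_const_mul' _ _ (ENNReal.ofReal_ne_top (r := lam k))]
  rw [← lintegral_finsetSum _ fun j _ => hm j,
    ← lintegral_add_right _ (Finset.measurable_fun_sum _ fun j _ => hm j)]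
  refine lintegral_mono fun ξ => ?_
  simp only [← ENNReal.ofReal_mul (hnn k)]
  rw [← ENNReal.ofReal_sum_of_nonneg fun j _ => mul_nonneg (hnn k) (sq_nonneg _),
    ← ENNReal.ofReal_add (sq_nonneg _)
      (Finset.sum_nonneg fun j _ => mul_nonneg (hnn k) (sq_nonneg _))]
  refine ENNReal.ofReal_le_ofReal
    ((eigenvalue_mul_norm_sq_le hopen hbdd hlam he k (landauH1 hopen hbdd β m ξ)).trans ?_)
  -- The weight `lam k - lam j` is relaxed to `lam k`, using nonnegativity of the eigenvalues.
  gcongr with j hj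
  linarith [hnn j]

theorem sum_range_two_mul_add_one (M : ℕ) : ∑ m ∈ Finset.range M, (2 * (m : ℝ) + 1) = M ^ 2 := by
  induction M with
  | zero => simp
  | succ M ih => rw [Finset.sum_range_succ, ih]; push_cast; ring

/-- The averaged variational inequality over the first `M` Landau levels. -/
theorem averaged_inequality (hopen : IsOpen Ω) (hbdd : Bornology.IsBounded Ω) {β : ℝ}
    (hβ : 0 < β) {lam : ℕ → ℝ} {e : HilbertBasis ℕ ℂ (L2 Ω)} (hlam : Monotone lam)
    (he : ∀ j, IsWeakSolution Ω β (lam j) (e j)) (k M : ℕ) :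
    β * volume.real Ω * (lam k * M - β * M ^ 2) ≤ 2 * Real.pi * (k * lam k) := by
  have hnn := IsWeakSolution.nonneg_of_hilbertBasis hopen hbdd he
  have hvol : volume Ω = ENNReal.ofReal (volume.real Ω) :=
    (ENNReal.ofReal_toReal hbdd.measure_lt_top.ne).symm
  have hsum := Finset.sum_le_sum fun m (_ : m ∈ Finset.range M) =>
    lintegral_variational_inequality hopen hbdd hβ hlam he k m
  have hbessel : ∑ m ∈ Finset.range M, ∑ j ∈ Finset.range k, ENNReal.ofReal (lam k) *
      ∫⁻ ξ, ENNReal.ofReal (‖inner ℂ (e j) (landauH1 hopen hbdd β m ξ).toL2‖ ^ 2) ≤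
        ENNReal.ofReal (k * (lam k * (2 * Real.pi / Real.sqrt (2 * β)))) := by
    rw [Finset.sum_comm, ENNReal.ofReal_mul k.cast_nonneg, ENNReal.ofReal_natCast, ← nsmul_eq_mul]
    refine (Finset.sum_le_card_nsmul _ _
      (ENNReal.ofReal (lam k * (2 * Real.pi / Real.sqrt (2 * β)))) fun j _ => ?_).trans_eq
        (by rw [Finset.card_range])
    rw [← Finset.mul_sum, ENNReal.ofReal_mul (hnn k), ← lintegral_finsetSum _ fun m _ =>
      measurable_inner_landauH1 hopen hbdd β m (e j)]
    have h := lintegral_sum_inner_landauH1_le hopen hbdd hβ (e j) M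
    rw [e.orthonormal.norm_eq_one j, one_pow, mul_one] at h
    gcongr
  rw [Finset.sum_add_distrib] at hsum
  replace hsum := hsum.trans (add_le_add_right hbessel _)
  have hA : 0 < Real.sqrt (β / 2) := by positivity
  have hV : 0 ≤ volume.real Ω := measureReal_nonneg
  rw [hvol] at hsum
  simp only [← ENNReal.ofReal_mul hA.le, ← ENNReal.ofReal_mul (hnn k), Finset.sum_const,
    Finset.card_range, nsmul_eq_mul] at hsum
  rw [← ENNReal.ofReal_natCast M, ← ENNReal.ofReal_mul M.cast_nonneg, ← Finset.sum_mul,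
    ← ENNReal.ofReal_sum_of_nonneg fun m _ => by positivity, ← ENNReal.ofReal_mul
      (Finset.sum_nonneg fun m _ => by positivity), ← ENNReal.ofReal_add
      (mul_nonneg (Finset.sum_nonneg fun m _ => by positivity) hV)
      (mul_nonneg k.cast_nonneg (mul_nonneg (hnn k) (by positivity))),
    ENNReal.ofReal_le_ofReal_iff (add_nonneg
      (mul_nonneg (Finset.sum_nonneg fun m _ => by positivity) hV)
      (mul_nonneg k.cast_nonneg (mul_nonneg (hnn k) (by positivity)))),
    ← Finset.mul_sum, ← Finset.mul_sum, sum_range_two_mul_add_one] at hsum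
  have hB : 0 < Real.sqrt (2 * β) := by positivity
  have hAB : Real.sqrt (2 * β) * Real.sqrt (β / 2) = β := by
    rw [← Real.sqrt_mul (by positivity), show 2 * β * (β / 2) = β ^ 2 by ring,
      Real.sqrt_sq hβ.le]
  -- Multiplying by √(2β) clears both roots, because √(2β)·√(β/2) = β.
  have h := mul_le_mul_of_nonneg_left hsum hB.le
  have h1 : Real.sqrt (2 * β) * (k * (lam k * (2 * Real.pi / Real.sqrt (2 * β)))) =
      2 * Real.pi * (k * lam k) := by
    field_simp
  rw [mul_add, h1] at h
  have h2 : Real.sqrt (2 * β) * (M * (lam k * (Real.sqrt (β / 2) * volume.real Ω))) =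
      β * volume.real Ω * (lam k * M) := by
    nth_rewrite 3 [← hAB]
    ring
  have h3 : Real.sqrt (2 * β) * (Real.sqrt (β / 2) * (β * (M : ℝ) ^ 2) * volume.real Ω) =
      β * volume.real Ω * (β * M ^ 2) := by
    nth_rewrite 4 [← hAB]
    ring
  rw [h2, h3] at h
  linarith

theorem sq_fluctuation_le (a : ℝ) : fluctuation a ^ 2 ≤ 1 / 4 := by
  have h1 := Int.floor_le a
  have h2 := (Int.lt_floor_add_one a).le
  rw [fluctuation]
  nlinarith

/-- The quadratic inequality obtained from the optimal number of Landau levels. -/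
theorem quadratic_inequality {lam β V k : ℝ} (hβ : 0 < β) (hlam : 0 ≤ lam)
    (h : ∀ M : ℕ, β * V * (lam * M - β * M ^ 2) ≤ 2 * Real.pi * (k * lam)) :
    V * (lam ^ 2 / 4 - β ^ 2 * fluctuation (lam / (2 * β) + 1 / 2) ^ 2) ≤
      2 * Real.pi * (k * lam) := by
  have h0 : 0 ≤ ⌊lam / (2 * β) + 1 / 2⌋ := Int.floor_nonneg.2 (by positivity)
  -- This M is an integer nearest to the vertex λ/(2β) of M ↦ λM − βM², and the signed distance
  -- λ/(2β) − M is exactly ψ.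
  obtain ⟨M, hM⟩ := Int.eq_ofNat_of_zero_le h0
  refine (le_of_eq ?_).trans (h M)
  rw [fluctuation, hM]
  simp only [Int.cast_natCast]
  field_simp
  ring

/-- Completing the square in Vλ/(4π) − k. -/
theorem le_of_quadratic_inequality {lam β V k p : ℝ} (hV : 0 < V)
    (h : V * (lam ^ 2 / 4 - β ^ 2 * p ^ 2) ≤ 2 * Real.pi * (k * lam)) :
    lam ≤ 4 * Real.pi / V *
      (k + Real.sqrt (k ^ 2 + β ^ 2 * V ^ 2 / (4 * Real.pi ^ 2) * p ^ 2)) := by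
  have hpi := Real.pi_pos
  have h1 : V * lam / (4 * Real.pi) - k ≤
      Real.sqrt (k ^ 2 + β ^ 2 * V ^ 2 / (4 * Real.pi ^ 2) * p ^ 2) := by
    refine Real.le_sqrt_of_sq_le ?_
    have h2 : (V * lam / (4 * Real.pi) - k) ^ 2 -
        (k ^ 2 + β ^ 2 * V ^ 2 / (4 * Real.pi ^ 2) * p ^ 2) =
        V / (4 * Real.pi ^ 2) *
          (V * (lam ^ 2 / 4 - β ^ 2 * p ^ 2) - 2 * Real.pi * (k * lam)) := by
      field_simp
      ring
    have h3 : V / (4 * Real.pi ^ 2) *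
          (V * (lam ^ 2 / 4 - β ^ 2 * p ^ 2) - 2 * Real.pi * (k * lam)) ≤ 0 :=
      mul_nonpos_of_nonneg_of_nonpos (by positivity) (by linarith)
    linarith
  have h4 : lam = 4 * Real.pi / V * (V * lam / (4 * Real.pi)) := by field_simp
  rw [h4]
  gcongr
  linarith

end Averaging

end MagneticNeumann

theorem mainTheorem7 (Ω : Set MagneticNeumann.Plane) (hopen : IsOpen Ω) (hconn : IsConnected Ω)
    (hbdd : Bornology.IsBounded Ω) (β : ℝ) (hβ : 0 < β)
    (hdisc : MagneticNeumann.HasDiscreteSpectrum Ω β) (k : ℕ) :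
    MagneticNeumann.eigenvalue Ω β (k + 1) ≤
        4 * Real.pi / volume.real Ω *
          ((k : ℝ) + Real.sqrt ((k : ℝ) ^ 2 +
            β ^ 2 * (volume.real Ω) ^ 2 / (4 * Real.pi ^ 2) *
              (MagneticNeumann.fluctuation
                (MagneticNeumann.eigenvalue Ω β (k + 1) / (2 * β) + 1 / 2)) ^ 2)) ∧
      MagneticNeumann.eigenvalue Ω β (k + 1) ≤ 8 * Real.pi * (k : ℝ) / volume.real Ω + β := by
  obtain ⟨lam, e, hlam, -, he⟩ := hdisc
  have hV : 0 < volume.real Ω :=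
    ENNReal.toReal_pos (hopen.measure_pos volume hconn.nonempty).ne' hbdd.measure_lt_top.ne
  have hpi := Real.pi_pos
  rw [MagneticNeumann.eigenvalue_eq hopen hbdd hlam he k]
  have hmain := MagneticNeumann.le_of_quadratic_inequality hV
    (MagneticNeumann.quadratic_inequality hβ
      (MagneticNeumann.IsWeakSolution.nonneg_of_hilbertBasis hopen hbdd he k)
      (MagneticNeumann.averaged_inequality hopen hbdd hβ hlam he k))
  refine ⟨hmain, hmain.trans ?_⟩
  have hψ := MagneticNeumann.sq_fluctuation_le (lam k / (2 * β) + 1 / 2)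
  -- Combines ψ² ≤ 1/4 with √(a² + b²) ≤ a + b for a, b ≥ 0.
  have hsqrt : Real.sqrt ((k : ℝ) ^ 2 + β ^ 2 * (volume.real Ω) ^ 2 / (4 * Real.pi ^ 2) *
      MagneticNeumann.fluctuation (lam k / (2 * β) + 1 / 2) ^ 2) ≤
        k + β * volume.real Ω / (4 * Real.pi) := by
    refine Real.sqrt_le_iff.2 ⟨by positivity, ?_⟩
    calc _ ≤ (k : ℝ) ^ 2 + β ^ 2 * (volume.real Ω) ^ 2 / (4 * Real.pi ^ 2) * (1 / 4) := by gcongr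
      _ = (k : ℝ) ^ 2 + (β * volume.real Ω / (4 * Real.pi)) ^ 2 := by field_simp
      _ ≤ _ := by
        have : 0 ≤ (k : ℝ) * (β * volume.real Ω / (4 * Real.pi)) := by positivity
        nlinarith
  calc _ ≤ 4 * Real.pi / volume.real Ω * (k + (k + β * volume.real Ω / (4 * Real.pi))) := by gcongr
    _ = _ := by field_simp; ring
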